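/- Let $n,p\ge 0$ be integers, let $M$ be a compact smooth $n$-dimensional manifold without boundary, and let $x:M\to\mathbb{R}^{n+p}$ be a smooth immersion. Let $\mathbf H$ be the mean curvature vector of $x$, that is, the (unnormalized) trace, with respect to the induced metric, of the second fundamental form of $x$. Suppose that $x$ is a self-shrinker: $\mathbf H=-x^{\perp}$ at every point of $M$, where $x^\perp$ is the component of the position vector $x$ normal to $M$. If either $|\mathbf H|^2$ is constant on $M$ or $|\mathbf H|^2\le n$ on $M$, then $|\mathbf H|^2\equiv n$ on $M$ and $x$ is a minimal immersion into the sphere $\mathbb{S}^{n+p-1}(\sqrt n)=\{y\in\mathbb{R}^{n+p}:|y|=\sqrt n\}$, that is, $x(M)\subset\mathbb{S}^{n+p-1}(\sqrt n)$ and the mean curvature vector of $x$ as an immersion into this sphere vanishes identically. -/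

import Mathlib

open scoped Manifold ContDiff InnerProductSpace

noncomputable section

namespace SelfShrinker

/- Throughout, `M` is an `n`-dimensional manifold (without boundary, modelled on `ℝⁿ`) and
`x : M → ℝᵐ` is a map into Euclidean space. -/

section

variable (n : ℕ) {m : ℕ} {M : Type*} [TopologicalSpace M] [ChartedSpace (EuclideanSpace ℝ (Fin n)) M]

/-- `x : M → ℝᵐ` is a smooth immersion: it is smooth and its differential is injective at every
point. -/
structure IsSmoothImmersion (x : M → EuclideanSpace ℝ (Fin m)) : Prop where
  contMDiff : ContMDiff (𝓡 n) 𝓘(ℝ, EuclideanSpace ℝ (Fin m)) ∞ x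
  injective_mfderiv : ∀ q : M,
    Function.Injective (mfderiv (𝓡 n) 𝓘(ℝ, EuclideanSpace ℝ (Fin m)) x q)

/-- The differential `dx_q : T_q M → ℝᵐ`. The tangent space `T_q M` is identified with `ℝⁿ` by
the preferred chart at `q` (this is how `TangentSpace` is defined). -/
def differential (x : M → EuclideanSpace ℝ (Fin m)) (q : M) :
    EuclideanSpace ℝ (Fin n) →L[ℝ] EuclideanSpace ℝ (Fin m) :=
  mfderiv (𝓡 n) 𝓘(ℝ, EuclideanSpace ℝ (Fin m)) x q

/-- The tangent plane `dx_q(T_q M) ⊆ ℝᵐ`. -/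
def tangentPlane (x : M → EuclideanSpace ℝ (Fin m)) (q : M) :
    Submodule ℝ (EuclideanSpace ℝ (Fin m)) :=
  LinearMap.range (differential n x q).toLinearMap

/-- The normal space of `M` at `q` in `ℝᵐ`. -/
def normalSpace (x : M → EuclideanSpace ℝ (Fin m)) (q : M) :
    Submodule ℝ (EuclideanSpace ℝ (Fin m)) :=
  (tangentPlane n x q)ᗮ

/-- The induced metric `g_{ij} = ⟨∂ᵢx, ∂ⱼx⟩` at `q` in the preferred chart at `q`. -/
def inducedMetric (x : M → EuclideanSpace ℝ (Fin m)) (q : M) : Matrix (Fin n) (Fin n) ℝ :=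
  Matrix.of fun i j =>
    ⟪differential n x q (EuclideanSpace.single i 1), differential n x q (EuclideanSpace.single j 1)⟫_ℝ

/-- The second derivatives `D²(x ∘ φ⁻¹)(v, w)` at `φ(q)`, with `φ` the preferred chart at `q`.
This is the derivative in `ℝᵐ`, along `v`, of the tangent field whose coordinates in the chart are
constantly `w`. -/
def coordHessian (x : M → EuclideanSpace ℝ (Fin m)) (q : M) (v w : EuclideanSpace ℝ (Fin n)) :
    EuclideanSpace ℝ (Fin m) :=
  fderiv ℝ (fderiv ℝ (x ∘ (extChartAt (𝓡 n) q).symm)) (extChartAt (𝓡 n) q q) v w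

/-- The trace `∑ᵢⱼ gⁱʲ B(∂ᵢ, ∂ⱼ)` of a bilinear map `B` on `T_q M` for the induced metric. -/
def metricTrace (x : M → EuclideanSpace ℝ (Fin m)) (q : M)
    (B : EuclideanSpace ℝ (Fin n) → EuclideanSpace ℝ (Fin n) → EuclideanSpace ℝ (Fin m)) :
    EuclideanSpace ℝ (Fin m) :=
  ∑ i, ∑ j, (inducedMetric n x q)⁻¹ i j •
    B (EuclideanSpace.single i 1) (EuclideanSpace.single j 1)

/-- The second fundamental form of `M` in `ℝᵐ`: the component normal to `M` of the derivative
in `ℝᵐ` of tangent fields. It does not depend on the chart. -/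
def secondFundamentalForm (x : M → EuclideanSpace ℝ (Fin m)) (q : M)
    (v w : EuclideanSpace ℝ (Fin n)) : EuclideanSpace ℝ (Fin m) :=
  (normalSpace n x q).starProjection (coordHessian n x q v w)

/-- The mean curvature vector `𝐇` of `M` in `ℝᵐ`: the (unnormalized) trace of the second
fundamental form. -/
def meanCurvature (x : M → EuclideanSpace ℝ (Fin m)) (q : M) : EuclideanSpace ℝ (Fin m) :=
  metricTrace n x q (secondFundamentalForm n x q)

/-- The self-shrinker equation `𝐇 = -x^⊥`. -/
structure IsSelfShrinker (x : M → EuclideanSpace ℝ (Fin m)) : Prop where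
  immersion : IsSmoothImmersion n x
  meanCurvature_eq : ∀ q : M, meanCurvature n x q = -(normalSpace n x q).starProjection (x q)

/-- For `M` immersed in a sphere centred at the origin, the normal space of `M` at `q` inside the
tangent space `(x(q))^⊥` of the sphere. -/
def sphereNormalSpace (x : M → EuclideanSpace ℝ (Fin m)) (q : M) :
    Submodule ℝ (EuclideanSpace ℝ (Fin m)) :=
  normalSpace n x q ⊓ (ℝ ∙ x q)ᗮ

/-- The second fundamental form of `M` in a sphere centred at the origin. The Levi-Civita
connection of the sphere is the part tangent to the sphere of the derivative in `ℝᵐ`, so this is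
the component, in the normal space of `M` in the sphere, of the derivative in `ℝᵐ` of tangent
fields. -/
def sphereSecondFundamentalForm (x : M → EuclideanSpace ℝ (Fin m)) (q : M)
    (v w : EuclideanSpace ℝ (Fin n)) : EuclideanSpace ℝ (Fin m) :=
  (sphereNormalSpace n x q).starProjection (coordHessian n x q v w)

/-- The mean curvature vector of `M` in a sphere centred at the origin. -/
def sphereMeanCurvature (x : M → EuclideanSpace ℝ (Fin m)) (q : M) : EuclideanSpace ℝ (Fin m) :=
  metricTrace n x q (sphereSecondFundamentalForm n x q)

/-- `x` immerses `M` as a minimal submanifold of the sphere of radius `r` about the origin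
of `ℝᵐ`. -/
structure IsMinimalInSphere (r : ℝ) (x : M → EuclideanSpace ℝ (Fin m)) : Prop where
  immersion : IsSmoothImmersion n x
  mem_sphere : ∀ q : M, x q ∈ Metric.sphere (0 : EuclideanSpace ℝ (Fin m)) r
  meanCurvature_eq_zero : ∀ q : M, sphereMeanCurvature n x q = 0

end

end SelfShrinker

end

/-! On a self-shrinker, tracing the Hessian of |x|²/2 gives Δ(|x|²/2) = n + ⟨x, H⟩ = n - |H|². At a
minimum of |x|² this forces |H|² ≤ n, so constant |H|² reduces to the case |H|² ≤ n. There |x|² is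
subharmonic, and on compact M the strong maximum principle makes it constant on each component. Its
first derivative then vanishes everywhere, so x is normal and H = -x; its Laplacian vanishes too, so
|H|² = n = |x|². The mean curvature in the sphere is a projection of H = -x onto a space orthogonal
to x, hence zero.

The maximum principle is proved directly, by Hopf's barrier argument. The barrier exp(-α|x - Y|²) is
built from an ambient point Y, so no Laplacian in coordinates is needed:
`IsSelfShrinker.barrier_of_isLocalMax` tests |x|² plus a barrier at a local maximum.
`exists_touching_ball` supplies Y, and `IsSelfShrinker.eventually_norm_sq_eq` derives the
contradiction. -/

namespace SelfShrinker

/-! ### Metric trace in an orthonormal frame -/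

section
variable {n m : ℕ} {M : Type*} [TopologicalSpace M] [ChartedSpace (EuclideanSpace ℝ (Fin n)) M]

lemma sum_apply_single_eq {F : Type*} [NormedAddCommGroup F] [NormedSpace ℝ F]
    (D : EuclideanSpace ℝ (Fin n) →L[ℝ] F) (v : EuclideanSpace ℝ (Fin n)) :
    D v = ∑ i, v i • D (EuclideanSpace.single i 1) := by
  have h := (EuclideanSpace.basisFun (Fin n) ℝ).sum_repr v
  conv_lhs => rw [← h]
  simp [map_sum]

/-- Pulling an orthonormal basis of the tangent plane back to `T_q M` diagonalises the trace for
the induced metric. -/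
lemma exists_orthonormal_frame (x : M → EuclideanSpace ℝ (Fin m)) (q : M)
    (hq : Function.Injective (differential n x q)) :
    ∃ v : Fin n → EuclideanSpace ℝ (Fin n),
      Orthonormal ℝ (fun k => differential n x q (v k)) ∧
      (∀ t ∈ tangentPlane n x q,
        t = ∑ k, ⟪differential n x q (v k), t⟫_ℝ • differential n x q (v k)) ∧
      ∀ B : EuclideanSpace ℝ (Fin n) →L[ℝ] EuclideanSpace ℝ (Fin n) →L[ℝ]
          EuclideanSpace ℝ (Fin m),
        metricTrace n x q (fun a b => B a b) = ∑ k, B (v k) (v k) := by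
  have hfin : Module.finrank ℝ (tangentPlane n x q) = n := by
    rw [tangentPlane, LinearMap.finrank_range_of_inj hq, finrank_euclideanSpace_fin]
  let b : OrthonormalBasis (Fin n) ℝ (tangentPlane n x q) :=
    (stdOrthonormalBasis ℝ (tangentPlane n x q)).reindex (finCongr hfin)
  have hb : ∀ k, ∃ w, differential n x q w = b k := fun k => (b k).2
  choose v hv using hb
  refine ⟨v, ?_, ?_, ?_⟩
  · simp only [hv]
    exact b.orthonormal.comp_linearIsometry (tangentPlane n x q).subtypeₗᵢ
  · intro t ht
    have h := congrArg (Subtype.val) (b.sum_repr' ⟨t, ht⟩)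
    simp only [hv]
    simpa using h.symm
  · intro B
    set V : Matrix (Fin n) (Fin n) ℝ := Matrix.of fun i k => v k i with hV
    have h1 : V.transpose * (inducedMetric n x q * V) = 1 := by
      ext k l
      have h2 : ⟪differential n x q (v k), differential n x q (v l)⟫_ℝ =
          (1 : Matrix (Fin n) (Fin n) ℝ) k l := by
        rw [hv, hv, ← Submodule.coe_inner, orthonormal_iff_ite.mp b.orthonormal,
          Matrix.one_apply]
      rw [← h2, sum_apply_single_eq _ (v k), sum_apply_single_eq _ (v l), sum_inner]
      simp only [Matrix.mul_apply, inducedMetric, hV, Matrix.transpose_apply, Matrix.of_apply,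
        inner_sum, inner_smul_left, inner_smul_right, Finset.mul_sum]
      refine Finset.sum_congr rfl fun i _ => Finset.sum_congr rfl fun j _ => ?_
      simp only [conj_trivial]
      ring
    -- VᵀGV = 1 expresses orthonormality of the frame; for square matrices this one-sided identity
    -- gives G(VVᵀ) = 1.
    have h3 : (inducedMetric n x q)⁻¹ = V * V.transpose := by
      apply Matrix.inv_eq_right_inv
      rw [← Matrix.mul_assoc]
      exact mul_eq_one_comm.mp h1
    have h4 : ∀ k, B (v k) (v k) = ∑ i, ∑ j, (v k i * v k j) •
        B (EuclideanSpace.single i 1) (EuclideanSpace.single j 1) := by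
      intro k
      conv_lhs => rw [sum_apply_single_eq B (v k)]
      rw [_root_.sum_apply]
      refine Finset.sum_congr rfl fun i _ => ?_
      rw [_root_.smul_apply, sum_apply_single_eq (B _) (v k), Finset.smul_sum]
      simp only [smul_smul]
    simp only [h4, metricTrace, h3]
    rw [Finset.sum_comm]
    conv_rhs => rw [Finset.sum_comm]
    rw [Finset.sum_comm]
    refine Finset.sum_congr rfl fun i _ => ?_
    rw [Finset.sum_comm]
    refine Finset.sum_congr rfl fun j _ => ?_
    simp only [Matrix.mul_apply, Matrix.transpose_apply, hV, Matrix.of_apply, Finset.sum_smul]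
end

/-! ### Derivative tests for the barrier function -/

/-- The necessary second-order condition at a local maximum. -/
lemma IsLocalMax.second_deriv_nonpos {u u' : ℝ → ℝ} {t d : ℝ} (hmax : IsLocalMax u t)
    (hu : ∀ᶠ s in nhds t, HasDerivAt u (u' s) s) (hu' : HasDerivAt u' d t) :
    u' t = 0 ∧ d ≤ 0 := by
  have h0 : u' t = 0 := hmax.hasDerivAt_eq_zero hu.self_of_nhds
  refine ⟨h0, ?_⟩
  by_contra! hd
  have he : deriv u =ᶠ[nhds t] u' := hu.mono fun s hs => hs.deriv
  have hdd : deriv (deriv u) t = d := by rw [he.deriv_eq, hu'.deriv]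
  -- If d > 0, then t is also a local minimum, so u is constant near t and d = 0.
  have hmin : IsLocalMin u t := isLocalMin_of_deriv_deriv_pos (hdd ▸ hd)
    (by rw [he.self_of_nhds, h0]) hu.self_of_nhds.continuousAt
  have hconst : u =ᶠ[nhds t] fun _ => u t := by
    filter_upwards [hmax, hmin] with s h1 h2 using le_antisymm h1 h2
  have h1 : deriv u =ᶠ[nhds t] fun _ => 0 := by
    have := hconst.deriv
    simpa using this
  rw [h1.deriv_eq, deriv_const] at hdd
  exact hd.ne hdd

/-- Two derivatives of the barrier function along a curve. -/
lemma barrier_derivs {F : Type*} [NormedAddCommGroup F] [InnerProductSpace ℝ F]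
    {c c' : ℝ → F} {W : F} {t : ℝ} (s ε α : ℝ) (Y : F)
    (hc : ∀ᶠ r in nhds t, HasDerivAt c (c' r) r) (hc' : HasDerivAt c' W t)
    (hmax : IsLocalMax (fun r => s / 2 * ‖c r‖ ^ 2 + ε * Real.exp (-α * ‖c r - Y‖ ^ 2)) t) :
    s * ⟪c t, c' t⟫_ℝ - 2 * α * ε * Real.exp (-α * ‖c t - Y‖ ^ 2) * ⟪c t - Y, c' t⟫_ℝ = 0 ∧
    s * (‖c' t‖ ^ 2 + ⟪c t, W⟫_ℝ) + ε * Real.exp (-α * ‖c t - Y‖ ^ 2) *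
      (4 * α ^ 2 * ⟪c t - Y, c' t⟫_ℝ ^ 2 - 2 * α * (‖c' t‖ ^ 2 + ⟪c t - Y, W⟫_ℝ)) ≤ 0 := by
  have hexp : ∀ r, HasDerivAt c (c' r) r →
      HasDerivAt (fun r => Real.exp (-α * ‖c r - Y‖ ^ 2))
        (Real.exp (-α * ‖c r - Y‖ ^ 2) * (-α * (2 * ⟪c r - Y, c' r⟫_ℝ))) r := by
    intro r hr
    exact (((hr.sub_const Y).norm_sq).const_mul (-α)).exp
  have hu : ∀ᶠ r in nhds t, HasDerivAt
      (fun r => s / 2 * ‖c r‖ ^ 2 + ε * Real.exp (-α * ‖c r - Y‖ ^ 2))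
      (s * ⟪c r, c' r⟫_ℝ - 2 * α * ε * Real.exp (-α * ‖c r - Y‖ ^ 2) * ⟪c r - Y, c' r⟫_ℝ) r := by
    filter_upwards [hc] with r hr
    exact ((hr.norm_sq.const_mul (s / 2)).add ((hexp r hr).const_mul ε)).congr_deriv (by ring)
  have h0 := hc.self_of_nhds
  have hu' := ((h0.inner ℝ hc').const_mul s).sub
    (((hexp t h0).const_mul (2 * α * ε)).mul ((h0.sub_const Y).inner ℝ hc'))
  obtain ⟨h1, h2⟩ := IsLocalMax.second_deriv_nonpos hmax hu hu'
  refine ⟨h1, le_of_eq_of_le ?_ h2⟩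
  simp only [real_inner_self_eq_norm_sq]
  ring

/-- First and second order conditions at a local maximum of a barrier function composed with a
twice differentiable parametrisation. -/
lemma barrier_derivs_fderiv {E F : Type*} [NormedAddCommGroup E] [NormedSpace ℝ E]
    [NormedAddCommGroup F] [InnerProductSpace ℝ F] {ψ : E → F} {y : E} (s ε α : ℝ) (Y : F)
    (hψ : ContDiffAt ℝ 2 ψ y)
    (hmax : IsLocalMax (fun b => s / 2 * ‖ψ b‖ ^ 2 + ε * Real.exp (-α * ‖ψ b - Y‖ ^ 2)) y)
    (v : E) :
    s * ⟪ψ y, fderiv ℝ ψ y v⟫_ℝ -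
        2 * α * ε * Real.exp (-α * ‖ψ y - Y‖ ^ 2) * ⟪ψ y - Y, fderiv ℝ ψ y v⟫_ℝ = 0 ∧
      s * (‖fderiv ℝ ψ y v‖ ^ 2 + ⟪ψ y, fderiv ℝ (fderiv ℝ ψ) y v v⟫_ℝ) +
        ε * Real.exp (-α * ‖ψ y - Y‖ ^ 2) * (4 * α ^ 2 * ⟪ψ y - Y, fderiv ℝ ψ y v⟫_ℝ ^ 2 -
          2 * α * (‖fderiv ℝ ψ y v‖ ^ 2 + ⟪ψ y - Y, fderiv ℝ (fderiv ℝ ψ) y v v⟫_ℝ)) ≤ 0 := by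
  have hline : ∀ r : ℝ, HasDerivAt (fun r : ℝ => y + r • v) v r := fun r => by
    simpa using ((hasDerivAt_id r).smul_const v).const_add y
  have hline0 : Filter.Tendsto (fun r : ℝ => y + r • v) (nhds 0) (nhds y) := by
    simpa using (hline 0).continuousAt.tendsto
  have hc : ∀ᶠ r in nhds (0 : ℝ), HasDerivAt (fun r : ℝ => ψ (y + r • v))
      (fderiv ℝ ψ (y + r • v) v) r := by
    filter_upwards [hline0.eventually (hψ.eventually (by simp))] with r hr
    exact (hr.differentiableAt (by simp)).hasFDerivAt.comp_hasDerivAt r (hline r)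
  have hc' : HasDerivAt (fun r : ℝ => fderiv ℝ ψ (y + r • v) v)
      (fderiv ℝ (fderiv ℝ ψ) y v v) 0 := by
    have h1 : DifferentiableAt ℝ (fderiv ℝ ψ) y :=
      (hψ.fderiv_right (m := 1) (by norm_num)).differentiableAt (by simp)
    have h2 : HasFDerivAt (fderiv ℝ ψ) (fderiv ℝ (fderiv ℝ ψ) y) (y + (0 : ℝ) • v) := by
      simpa using h1.hasFDerivAt
    have h3 : HasDerivAt (fun r : ℝ => fderiv ℝ ψ (y + r • v))
        (fderiv ℝ (fderiv ℝ ψ) y v) 0 :=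
      HasFDerivAt.comp_hasDerivAt (0 : ℝ) (l := fderiv ℝ ψ) h2 (hline 0)
    exact (ContinuousLinearMap.apply ℝ F v).hasFDerivAt.comp_hasDerivAt (0 : ℝ) h3
  have hmax' : IsLocalMax (fun r : ℝ => s / 2 * ‖ψ (y + r • v)‖ ^ 2 +
      ε * Real.exp (-α * ‖ψ (y + r • v) - Y‖ ^ 2)) 0 := by
    filter_upwards [hline0.eventually hmax] with r hr
    simpa using hr
  simpa using barrier_derivs s ε α Y hc hc' hmax'

/-! ### Self-shrinkers in a chart and the barrier inequality -/

section
variable {n m : ℕ} {M : Type*} [TopologicalSpace M] [ChartedSpace (EuclideanSpace ℝ (Fin n)) M]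

lemma IsSmoothImmersion.contDiffOn_chart [IsManifold (𝓡 n) ∞ M]
    {x : M → EuclideanSpace ℝ (Fin m)} (hx : IsSmoothImmersion n x) (q : M) :
    ContDiffOn ℝ ∞ (x ∘ (extChartAt (𝓡 n) q).symm) (extChartAt (𝓡 n) q).target := by
  rw [← contMDiffOn_iff_contDiffOn]
  exact hx.contMDiff.comp_contMDiffOn (contMDiffOn_extChartAt_symm q)

lemma IsSmoothImmersion.contDiffAt_chart [IsManifold (𝓡 n) ∞ M]
    {x : M → EuclideanSpace ℝ (Fin m)} (hx : IsSmoothImmersion n x) (q : M)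
    {b : EuclideanSpace ℝ (Fin n)} (hb : b ∈ (extChartAt (𝓡 n) q).target) :
    ContDiffAt ℝ ∞ (x ∘ (extChartAt (𝓡 n) q).symm) b :=
  (hx.contDiffOn_chart q).contDiffAt ((isOpen_extChartAt_target q).mem_nhds hb)

lemma IsSmoothImmersion.differential_eq [IsManifold (𝓡 n) ∞ M]
    {x : M → EuclideanSpace ℝ (Fin m)} (hx : IsSmoothImmersion n x) (q : M) :
    differential n x q = fderiv ℝ (x ∘ (extChartAt (𝓡 n) q).symm) (extChartAt (𝓡 n) q q) := by
  have h : MDifferentiableAt (𝓡 n) 𝓘(ℝ, EuclideanSpace ℝ (Fin m)) x q :=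
    (hx.contMDiff q).mdifferentiableAt (by simp)
  have h1 := h.mfderiv
  simp only [writtenInExtChartAt, extChartAt_model_space_eq_id, PartialEquiv.refl_coe,
    Function.id_comp, modelWithCornersSelf_coe, Set.range_id, fderivWithin_univ] at h1
  exact h1

/-- By the chain rule. This lets the maximum principle work in one fixed chart, although each
tangent plane is defined through the preferred chart at its own point. -/
lemma IsSmoothImmersion.fderiv_chart_mem_tangentPlane [IsManifold (𝓡 n) ∞ M]
    {x : M → EuclideanSpace ℝ (Fin m)} (hx : IsSmoothImmersion n x) (q : M)
    {b : EuclideanSpace ℝ (Fin n)} (hb : b ∈ (extChartAt (𝓡 n) q).target)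
    (v : EuclideanSpace ℝ (Fin n)) :
    fderiv ℝ (x ∘ (extChartAt (𝓡 n) q).symm) b v ∈
      tangentPlane n x ((extChartAt (𝓡 n) q).symm b) := by
  have h1 : MDifferentiableAt (𝓡 n) 𝓘(ℝ, EuclideanSpace ℝ (Fin m)) x
      ((extChartAt (𝓡 n) q).symm b) :=
    (hx.contMDiff _).mdifferentiableAt (by simp)
  have h2 : MDifferentiableAt 𝓘(ℝ, EuclideanSpace ℝ (Fin n)) (𝓡 n)
      (extChartAt (𝓡 n) q).symm b :=
    ((contMDiffOn_extChartAt_symm (n := ∞) q).contMDiffAt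
      ((isOpen_extChartAt_target q).mem_nhds hb)).mdifferentiableAt (by simp)
  rw [← mfderiv_eq_fderiv, mfderiv_comp b h1 h2]
  exact ⟨_, rfl⟩

lemma IsSmoothImmersion.meanCurvature_eq_sum {x : M → EuclideanSpace ℝ (Fin m)} {q : M}
    {v : Fin n → EuclideanSpace ℝ (Fin n)}
    (hv : ∀ B : EuclideanSpace ℝ (Fin n) →L[ℝ] EuclideanSpace ℝ (Fin n) →L[ℝ]
      EuclideanSpace ℝ (Fin m), metricTrace n x q (fun a b => B a b) = ∑ k, B (v k) (v k)) :
    meanCurvature n x q =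
      (normalSpace n x q).starProjection (∑ k, coordHessian n x q (v k) (v k)) := by
  rw [map_sum]
  exact hv (((ContinuousLinearMap.compL ℝ _ _ _) (normalSpace n x q).starProjection).comp
    (fderiv ℝ (fderiv ℝ (x ∘ (extChartAt (𝓡 n) q).symm)) (extChartAt (𝓡 n) q q)))

/-- The normal projection is symmetric and idempotent. This identity turns n + ⟨x, H⟩ into n - |H|².
-/
lemma IsSelfShrinker.inner_meanCurvature {x : M → EuclideanSpace ℝ (Fin m)}
    (hx : IsSelfShrinker n x) (q : M) :
    ⟪x q, meanCurvature n x q⟫_ℝ = -‖meanCurvature n x q‖ ^ 2 := by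
  have h := (normalSpace n x q).inner_starProjection_left_eq_right (x q)
    ((normalSpace n x q).starProjection (x q))
  rw [Submodule.starProjection_eq_self_iff.2 (Submodule.starProjection_apply_mem _ _)] at h
  rw [hx.meanCurvature_eq, inner_neg_right, norm_neg, ← real_inner_self_eq_norm_sq, h]

/-- A projection does not increase norms. The bound replaces H by the continuous quantity |x| in the
barrier estimate, so continuity of H is never needed. -/
lemma IsSelfShrinker.norm_meanCurvature_le {x : M → EuclideanSpace ℝ (Fin m)}
    (hx : IsSelfShrinker n x) (q : M) : ‖meanCurvature n x q‖ ≤ ‖x q‖ := by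
  rw [hx.meanCurvature_eq, norm_neg]
  exact Submodule.norm_starProjection_apply_le _ _

/-- First and second order conditions at a local maximum of `s |x|² / 2 + ε exp (-α |x - Y|²)`
on a self-shrinker. The number `T` is the squared length of the tangential part of `x - Y`. -/
lemma IsSelfShrinker.barrier_of_isLocalMax [IsManifold (𝓡 n) ∞ M]
    {x : M → EuclideanSpace ℝ (Fin m)} (hx : IsSelfShrinker n x) {q : M} (s ε α : ℝ)
    (Y : EuclideanSpace ℝ (Fin m))
    (hmax : IsLocalMax (fun p => s / 2 * ‖x p‖ ^ 2 + ε * Real.exp (-α * ‖x p - Y‖ ^ 2)) q) :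
    (∀ t ∈ tangentPlane n x q,
      s * ⟪x q, t⟫_ℝ - 2 * α * ε * Real.exp (-α * ‖x q - Y‖ ^ 2) * ⟪x q - Y, t⟫_ℝ = 0) ∧
    ∃ T : ℝ, (∀ t ∈ tangentPlane n x q, ⟪x q - Y, t⟫_ℝ ^ 2 ≤ ‖t‖ ^ 2 * T) ∧
      s * (n - ‖meanCurvature n x q‖ ^ 2) + ε * Real.exp (-α * ‖x q - Y‖ ^ 2) *
        (4 * α ^ 2 * T - 2 * α * (n + ⟪x q - Y, meanCurvature n x q⟫_ℝ)) ≤ 0 := by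
  obtain ⟨v, hon, hspan, htr⟩ := exists_orthonormal_frame x q (hx.immersion.injective_mfderiv q)
  set D := differential n x q with hD
  set ψ := x ∘ (extChartAt (𝓡 n) q).symm with hψ
  set y := extChartAt (𝓡 n) q q with hy
  have hψy : ψ y = x q := by simp [hψ, hy]
  have hsm : ContDiffAt ℝ ∞ ψ y :=
    hx.immersion.contDiffAt_chart q (mem_extChartAt_target q)
  have hDe : D = fderiv ℝ ψ y := hx.immersion.differential_eq q
  have hmax' : IsLocalMax (fun b => s / 2 * ‖ψ b‖ ^ 2 + ε * Real.exp (-α * ‖ψ b - Y‖ ^ 2)) y := by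
    have h1 := (continuousAt_extChartAt_symm (I := 𝓡 n) q).tendsto
    rw [extChartAt_to_inv] at h1
    filter_upwards [h1.eventually hmax] with b hb
    rw [hψy]
    exact hb
  have key : ∀ k, s * ⟪x q, D (v k)⟫_ℝ -
        2 * α * ε * Real.exp (-α * ‖x q - Y‖ ^ 2) * ⟪x q - Y, D (v k)⟫_ℝ = 0 ∧
      s * (1 + ⟪x q, coordHessian n x q (v k) (v k)⟫_ℝ) +
        ε * Real.exp (-α * ‖x q - Y‖ ^ 2) * (4 * α ^ 2 * ⟪x q - Y, D (v k)⟫_ℝ ^ 2 -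
          2 * α * (1 + ⟪x q - Y, coordHessian n x q (v k) (v k)⟫_ℝ)) ≤ 0 := by
    intro k
    have h := barrier_derivs_fderiv s ε α Y (contDiffAt_infty.mp hsm 2) hmax' (v k)
    rw [hψy, ← hDe, show ‖D (v k)‖ = 1 from hon.1 k, one_pow] at h
    exact h
  set e := Real.exp (-α * ‖x q - Y‖ ^ 2) with he
  have hfirst : ∀ t ∈ tangentPlane n x q,
      s * ⟪x q, t⟫_ℝ - 2 * α * ε * e * ⟪x q - Y, t⟫_ℝ = 0 := by
    intro t ht
    rw [hspan t ht, inner_sum, inner_sum, Finset.mul_sum, Finset.mul_sum,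
      ← Finset.sum_sub_distrib]
    refine Finset.sum_eq_zero fun k _ => ?_
    rw [inner_smul_right, inner_smul_right]
    linear_combination ⟪D (v k), t⟫_ℝ * (key k).1
  refine ⟨hfirst, ∑ k, ⟪x q - Y, D (v k)⟫_ℝ ^ 2, ?_, ?_⟩
  · intro t ht
    have h1 : ⟪x q - Y, t⟫_ℝ = ∑ k, ⟪D (v k), t⟫_ℝ * ⟪x q - Y, D (v k)⟫_ℝ := by
      conv_lhs => rw [hspan t ht, inner_sum]
      simp only [inner_smul_right]
    have h2 : ∑ k, ⟪D (v k), t⟫_ℝ ^ 2 ≤ ‖t‖ ^ 2 := by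
      simpa using hon.sum_inner_products_le (x := t) (s := Finset.univ)
    rw [h1]
    refine (Finset.sum_mul_sq_le_sq_mul_sq _ _ _).trans ?_
    exact mul_le_mul_of_nonneg_right h2 (Finset.sum_nonneg fun k _ => sq_nonneg _)
  · set W := ∑ k, coordHessian n x q (v k) (v k) with hW
    have hH := IsSmoothImmersion.meanCurvature_eq_sum htr
    -- The chart need not be normal at q, so W may have a tangential part. The first-order condition
    -- on that part replaces W by H in the summed second-order inequality.
    have htan : W - meanCurvature n x q ∈ tangentPlane n x q := by
      rw [hH, ← Submodule.orthogonal_orthogonal (tangentPlane n x q)]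
      exact Submodule.sub_starProjection_mem_orthogonal W
    have h1 := hfirst _ htan
    rw [inner_sub_right, inner_sub_right, hx.inner_meanCurvature] at h1
    have h2 := Finset.sum_le_sum fun k (_ : k ∈ Finset.univ) => (key k).2
    simp only [Finset.sum_add_distrib, Finset.sum_sub_distrib, ← Finset.mul_sum,
      Finset.sum_const_zero, ← inner_sum, Finset.sum_const, Finset.card_univ, Fintype.card_fin,
      nsmul_eq_mul, mul_one] at h2
    rw [← hW] at h2
    linear_combination h2 - h1
end

/-! ### Chord estimates and the touching ball -/

/-- Near a point where its derivative is injective, a `C¹` map is bi-Lipschitz, and chords make a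
definite angle with the normal spaces. -/
lemma exists_chord_estimates {E F : Type*} [NormedAddCommGroup E] [NormedSpace ℝ E]
    [FiniteDimensional ℝ E] [NormedAddCommGroup F] [InnerProductSpace ℝ F] {ψ : E → F} {y : E}
    (hψ : ContDiffAt ℝ 1 ψ y) (hinj : Function.Injective (fderiv ℝ ψ y)) :
    ∃ δ > 0, ∃ κ > 0, ∃ C > 0, ∀ a ∈ Metric.ball y δ, ∀ b ∈ Metric.ball y δ,
      κ * ‖b - a‖ ≤ ‖ψ b - ψ a‖ ∧ ‖ψ b - ψ a‖ ≤ C * ‖b - a‖ ∧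
      (b ≠ a → 0 < ⟪ψ b - ψ a, fderiv ℝ ψ b (b - a)⟫_ℝ) := by
  set L := fderiv ℝ ψ y with hL
  obtain ⟨K, hK0, hK⟩ := L.toLinearMap.injective_iff_antilipschitz.mp hinj
  have hK0' : (0 : ℝ) < K := hK0
  have hlow : ∀ v, ‖v‖ ≤ K * ‖L v‖ := fun v => by
    have := hK.le_mul_dist v 0
    simpa using this
  -- With this c each linearisation error is at most ‖L(b - a)‖/4, so the inner product keeps at
  -- least 1 - 1/4 - 1/4 - 1/16 of ‖L(b - a)‖².
  set c : ℝ := (4 * K : ℝ)⁻¹ with hc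
  have hc0 : 0 < c := by positivity
  have hcK : c * K = 1 / 4 := by rw [hc]; field_simp
  have hstrict : HasStrictFDerivAt ψ L y := hψ.hasStrictFDerivAt (by simp)
  have h1 : ∀ᶠ p : E × E in nhds (y, y), ‖ψ p.1 - ψ p.2 - L (p.1 - p.2)‖ ≤ c * ‖p.1 - p.2‖ :=
    hstrict.isLittleO.def hc0
  have h2 : ∀ᶠ b in nhds y, ‖fderiv ℝ ψ b - L‖ < c := by
    have hcont : ContinuousAt (fderiv ℝ ψ) y :=
      (hψ.fderiv_right (m := 0) (by simp)).continuousAt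
    have := hcont.eventually (Metric.ball_mem_nhds _ hc0)
    filter_upwards [this] with b hb
    simpa [dist_eq_norm] using hb
  rw [nhds_prod_eq] at h1
  obtain ⟨U, hU, V, hV, hUV⟩ := Filter.eventually_prod_iff.mp h1
  obtain ⟨δ, hδ, hball⟩ := Metric.eventually_nhds_iff_ball.mp ((hU.and hV).and h2)
  refine ⟨δ, hδ, 3 * c, by positivity, ‖L‖ + c, by positivity, fun a ha b hb => ?_⟩
  have e1 : ‖ψ b - ψ a - L (b - a)‖ ≤ c * ‖b - a‖ := hUV (hball b hb).1.1 (hball a ha).1.2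
  have e2 : ‖fderiv ℝ ψ b (b - a) - L (b - a)‖ ≤ c * ‖b - a‖ :=
    ((fderiv ℝ ψ b - L).le_opNorm (b - a)).trans
      (mul_le_mul_of_nonneg_right (hball b hb).2.le (norm_nonneg _))
  have e3 := hlow (b - a)
  have e4 : 4 * (c * ‖b - a‖) ≤ ‖L (b - a)‖ := by
    have := mul_le_mul_of_nonneg_left e3 hc0.le
    rw [← mul_assoc, hcK] at this
    linarith
  refine ⟨?_, ?_, fun hne => ?_⟩
  · have := norm_sub_norm_le (L (b - a)) (L (b - a) - (ψ b - ψ a))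
    rw [sub_sub_cancel, norm_sub_rev (L (b - a))] at this
    linarith
  · have := norm_add_le (ψ b - ψ a - L (b - a)) (L (b - a))
    rw [sub_add_cancel] at this
    have := L.le_opNorm (b - a)
    linarith
  · have hpos : 0 < c * ‖b - a‖ := mul_pos hc0 (norm_pos_iff.mpr (sub_ne_zero.mpr hne))
    set w := L (b - a)
    set u₁ := ψ b - ψ a - w with hu₁
    set u₂ := fderiv ℝ ψ b (b - a) - w with hu₂
    rw [show ψ b - ψ a = w + u₁ by rw [hu₁]; abel,
      show fderiv ℝ ψ b (b - a) = w + u₂ by rw [hu₂]; abel, inner_add_left, inner_add_right,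
      inner_add_right, real_inner_self_eq_norm_sq]
    have i1 := abs_le.mp (abs_real_inner_le_norm w u₂)
    have i2 := abs_le.mp (abs_real_inner_le_norm u₁ w)
    have i3 := abs_le.mp (abs_real_inner_le_norm u₁ u₂)
    have j1 : ‖w‖ * ‖u₂‖ ≤ ‖w‖ * (‖w‖ / 4) := by gcongr; linarith
    have j2 : ‖u₁‖ * ‖w‖ ≤ (‖w‖ / 4) * ‖w‖ := by gcongr; linarith
    have j3 : ‖u₁‖ * ‖u₂‖ ≤ (‖w‖ / 4) * (‖w‖ / 4) := by
      gcongr <;> linarith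
    have hw : 0 < ‖w‖ ^ 2 := by
      have : 0 < ‖w‖ := by linarith
      positivity
    nlinarith

/-- If a relatively closed set `S` is not a neighbourhood of one of its points `y`, its image under
a parametrisation is touched near `y` from outside by a ball whose centre is not in the normal
direction, and the touching is strict. -/
lemma exists_touching_ball {E F : Type*} [NormedAddCommGroup E] [NormedSpace ℝ E]
    [FiniteDimensional ℝ E] [NormedAddCommGroup F] [InnerProductSpace ℝ F] {ψ : E → F} {y : E}
    (hψ : ContDiffAt ℝ 1 ψ y) (hinj : Function.Injective (fderiv ℝ ψ y))
    {S : Set E} {ρ : ℝ} (hρ : 0 < ρ) (hcont : ContinuousOn ψ (Metric.closedBall y ρ))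
    (hS : IsClosed (S ∩ Metric.closedBall y ρ)) (hy : y ∈ S) (hyS : S ∉ nhds y) :
    ∃ b ∈ S, b ∈ Metric.ball y ρ ∧ ∃ (Y : F) (v : E), 0 < ⟪ψ b - Y, fderiv ℝ ψ b v⟫_ℝ ∧
      ∀ᶠ a in nhds b, a ∈ S → ‖ψ a - Y‖ ≤ ‖ψ b - Y‖ → a = b := by
  obtain ⟨δ, hδ, κ, hκ, C, hC, hest⟩ := exists_chord_estimates hψ hinj
  set δ' := min (δ / 2) ρ with hδ'
  have hδ'0 : 0 < δ' := lt_min (by positivity) hρ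
  have hKδ : Metric.closedBall y δ' ⊆ Metric.ball y δ :=
    Metric.closedBall_subset_ball ((min_le_left _ _).trans_lt (by linarith))
  have hKρ : Metric.closedBall y δ' ⊆ Metric.closedBall y ρ :=
    Metric.closedBall_subset_closedBall (min_le_right _ _)
  -- A point b of S nearest to a in image distance satisfies ‖b - y‖ < (1 + C/κ)η = δ'/2, so it is
  -- interior to the ball.
  set η := δ' / (2 * (1 + C / κ)) with hη
  have hη0 : 0 < η := by positivity
  have hηδ : η * (1 + C / κ) = δ' / 2 := by rw [hη]; field_simp
  have hηlt : η < δ' := by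
    have : 0 < η * (C / κ) := by positivity
    linarith
  obtain ⟨a, ha, haS⟩ : ∃ a ∈ Metric.ball y η, a ∉ S := by
    by_contra! h
    exact hyS (Filter.mem_of_superset (Metric.ball_mem_nhds y hη0) h)
  have haδ : a ∈ Metric.ball y δ :=
    hKδ (Metric.ball_subset_closedBall (Metric.ball_subset_ball hηlt.le ha))
  have hcomp : IsCompact (S ∩ Metric.closedBall y δ') := by
    have h1 : S ∩ Metric.closedBall y δ' =
        Metric.closedBall y δ' ∩ (S ∩ Metric.closedBall y ρ) := by
      ext b
      exact ⟨fun h => ⟨h.2, h.1, hKρ h.2⟩, fun h => ⟨h.2.1, h.1⟩⟩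
    rw [h1]
    exact (isCompact_closedBall y δ').inter_right hS
  have hyK : y ∈ S ∩ Metric.closedBall y δ' := ⟨hy, Metric.mem_closedBall_self hδ'0.le⟩
  obtain ⟨b, ⟨hbS, hbK⟩, hbmin⟩ := hcomp.exists_isMinOn ⟨y, hyK⟩
    (f := fun b => ‖ψ b - ψ a‖)
    (((hcont.mono (Set.inter_subset_right.trans hKρ)).sub continuousOn_const).norm)
  have hba : b ≠ a := fun h => haS (h ▸ hbS)
  have hay : ‖a - y‖ < η := by simpa [dist_eq_norm] using ha
  have hb1 : κ * ‖b - a‖ ≤ C * η := by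
    have h1 := (hest a haδ b (hKδ hbK)).1
    have h2 : ‖ψ b - ψ a‖ ≤ ‖ψ y - ψ a‖ := hbmin hyK
    have h3 := (hest a haδ y (Metric.mem_ball_self hδ)).2.1
    rw [norm_sub_rev y a] at h3
    have h4 := mul_le_mul_of_nonneg_left hay.le hC.le
    linarith
  have hbint : b ∈ Metric.ball y δ' := by
    rw [mem_ball_iff_norm]
    have h1 : ‖b - a‖ ≤ C / κ * η := by
      rw [div_mul_eq_mul_div, le_div_iff₀ hκ]
      linarith
    have h2 := norm_add_le (b - a) (a - y)
    rw [sub_add_sub_cancel] at h2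
    linarith
  -- The ball about ψ a through ψ b may meet the image of S at other points. The half-size ball
  -- centred at the midpoint is internally tangent to it at ψ b, which makes the contact strict.
  refine ⟨b, hbS, Metric.ball_subset_ball (min_le_right _ _) hbint,
    ψ a + (2⁻¹ : ℝ) • (ψ b - ψ a), b - a, ?_, ?_⟩
  · have h1 := (hest a haδ b (hKδ hbK)).2.2 hba
    have h2 : ψ b - (ψ a + (2⁻¹ : ℝ) • (ψ b - ψ a)) = (2⁻¹ : ℝ) • (ψ b - ψ a) := by
      module
    rw [h2, inner_smul_left]
    simpa using h1
  · filter_upwards [Metric.isOpen_ball.mem_nhds hbint] with z hz hzS hle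
    have hzK := Metric.ball_subset_closedBall hz
    have hmin : ‖ψ b - ψ a‖ ≤ ‖ψ z - ψ a‖ := hbmin ⟨hzS, hzK⟩
    set P := ψ z - ψ a with hP
    set Q := ψ b - ψ a with hQ
    have h1 : ψ z - (ψ a + (2⁻¹ : ℝ) • Q) = P - (2⁻¹ : ℝ) • Q := by rw [hP]; abel
    have h2 : ψ b - (ψ a + (2⁻¹ : ℝ) • Q) = (2⁻¹ : ℝ) • Q := by rw [hQ]; module
    rw [h1, h2] at hle
    have h3 := mul_self_le_mul_self (norm_nonneg _) hle
    rw [← pow_two, ← pow_two, norm_sub_sq_real, inner_smul_right] at h3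
    have h4 := mul_self_le_mul_self (norm_nonneg _) hmin
    have h5 : ‖P - Q‖ ^ 2 ≤ 0 := by
      rw [norm_sub_sq_real]
      nlinarith
    have h6 : P = Q := by
      rw [← sub_eq_zero, ← norm_eq_zero]
      exact pow_eq_zero_iff (two_ne_zero) |>.mp (le_antisymm h5 (sq_nonneg _))
    have h7 := (hest b (hKδ hbK) z (hKδ hzK)).1
    rw [show ψ z - ψ b = P - Q by rw [hP, hQ]; abel, h6, sub_self, norm_zero] at h7
    have h8 : ‖z - b‖ ≤ 0 := by
      by_contra! h
      have := mul_pos hκ h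
      linarith
    exact sub_eq_zero.mp (norm_le_zero_iff.mp h8)

/-! ### Strong maximum principle -/

section
variable {n m : ℕ} {M : Type*} [TopologicalSpace M] [ChartedSpace (EuclideanSpace ℝ (Fin n)) M]

/-- The strong maximum principle for `|x|²` on a self-shrinker with `|𝐇|² ≤ n`. -/
lemma IsSelfShrinker.eventually_norm_sq_eq [IsManifold (𝓡 n) ∞ M]
    {x : M → EuclideanSpace ℝ (Fin m)} (hx : IsSelfShrinker n x)
    (hH : ∀ q : M, ‖meanCurvature n x q‖ ^ 2 ≤ (n : ℝ)) {p : M}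
    (hmax : IsLocalMax (fun q => ‖x q‖ ^ 2) p) : ∀ᶠ q in nhds p, ‖x q‖ ^ 2 = ‖x p‖ ^ 2 := by
  set ψ := x ∘ (extChartAt (𝓡 n) p).symm with hψ
  set y := extChartAt (𝓡 n) p p with hy
  have hψφ : ∀ q ∈ (extChartAt (𝓡 n) p).source, ψ (extChartAt (𝓡 n) p q) = x q := fun q hq =>
    congrArg x ((extChartAt (𝓡 n) p).left_inv hq)
  have hyt : y ∈ (extChartAt (𝓡 n) p).target := mem_extChartAt_target p
  have hψy : ψ y = x p := hψφ p (mem_extChartAt_source p)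
  have hsm : ∀ b ∈ (extChartAt (𝓡 n) p).target, ContDiffAt ℝ 1 ψ b := fun b hb =>
    contDiffAt_infty.mp (hx.immersion.contDiffAt_chart p hb) 1
  have hinj : Function.Injective (fderiv ℝ ψ y) := by
    rw [← hx.immersion.differential_eq p]
    exact hx.immersion.injective_mfderiv p
  have hle : ∀ᶠ b in nhds y, ‖ψ b‖ ^ 2 ≤ ‖x p‖ ^ 2 := by
    have h1 := (continuousAt_extChartAt_symm (I := 𝓡 n) p).tendsto
    rw [extChartAt_to_inv] at h1
    exact h1.eventually hmax
  obtain ⟨ρ, hρ, hball⟩ := Metric.nhds_basis_closedBall.mem_iff.mp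
    (Filter.inter_mem ((isOpen_extChartAt_target (I := 𝓡 n) p).mem_nhds hyt) hle)
  set S : Set (EuclideanSpace ℝ (Fin n)) := {b | ‖ψ b‖ ^ 2 = ‖x p‖ ^ 2} with hS
  have hcont : ContinuousOn ψ (Metric.closedBall y ρ) := fun b hb =>
    (hsm b (hball hb).1).continuousAt.continuousWithinAt
  have hSclosed : IsClosed (S ∩ Metric.closedBall y ρ) := by
    rw [Set.inter_comm]
    exact (hcont.norm.pow 2).preimage_isClosed_of_isClosed Metric.isClosed_closedBall
      isClosed_singleton
  by_contra hnot
  have hyS : S ∉ nhds y := fun h => hnot <| by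
    filter_upwards [(continuousAt_extChartAt (I := 𝓡 n) p).preimage_mem_nhds h,
      extChartAt_source_mem_nhds (I := 𝓡 n) p] with q hq hqs
    rw [← hψφ q hqs]
    exact hq
  obtain ⟨b, hbS, hbρ, Y, v, hpos, htouch⟩ := exists_touching_ball (hsm y hyt) hinj hρ hcont
    hSclosed (by simp [hS, hψy]) hyS
  have hbt := (hball (Metric.ball_subset_closedBall hbρ)).1
  -- With t = Dψ(v), N bounds |t|²(n + ⟨x - Y, H⟩) through |H| ≤ |x|. The choice of α makes 2α⟨x -
  -- Y, t⟩² exceed N by 1 at b, hence strictly near b by continuity.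
  set N : EuclideanSpace ℝ (Fin n) → ℝ := fun a =>
    ‖fderiv ℝ ψ a v‖ ^ 2 * (n + ‖ψ a - Y‖ * ‖ψ a‖) with hN
  have hN0 : ∀ a, 0 ≤ N a := fun a => by positivity
  set α := (N b + 1) / (2 * ⟪ψ b - Y, fderiv ℝ ψ b v⟫_ℝ ^ 2) with hα
  have hα0 : 0 < α := by
    have := hN0 b
    positivity
  have hΦb : 0 < 2 * α * ⟪ψ b - Y, fderiv ℝ ψ b v⟫_ℝ ^ 2 - N b := by
    have : 2 * α * ⟪ψ b - Y, fderiv ℝ ψ b v⟫_ℝ ^ 2 = N b + 1 := by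
      rw [hα]
      field_simp
    linarith
  have hΦ : ∀ᶠ a in nhds b, 0 < 2 * α * ⟪ψ a - Y, fderiv ℝ ψ a v⟫_ℝ ^ 2 - N a := by
    have h1 : ContinuousAt ψ b := (hsm b hbt).continuousAt
    have h2 : ContinuousAt (fun a => fderiv ℝ ψ a v) b :=
      ((hsm b hbt).fderiv_right (m := 0) (by simp)).continuousAt.clm_apply continuousAt_const
    have h3 : ContinuousAt (fun a => 2 * α * ⟪ψ a - Y, fderiv ℝ ψ a v⟫_ℝ ^ 2 - N a) b := by
      have h4 := (h1.sub (continuousAt_const (y := Y))).inner (𝕜 := ℝ) h2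
      have h5 := (h1.sub (continuousAt_const (y := Y))).norm.mul h1.norm
      exact (continuousAt_const.mul (h4.pow 2)).sub
        ((h2.norm.pow 2).mul (continuousAt_const.add h5))
    exact h3.eventually (lt_mem_nhds hΦb)
  obtain ⟨r, hr, hrball⟩ := Metric.nhds_basis_closedBall.mem_iff.mp
    (Filter.inter_mem (Filter.inter_mem htouch hΦ) (Metric.isOpen_ball.mem_nhds hbρ))
  have hrρ : Metric.closedBall b r ⊆ Metric.closedBall y ρ := fun a ha =>
    Metric.ball_subset_closedBall (hrball ha).2
  have hcontr := hcont.mono hrρ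
  -- Strict touching and compactness leave a gap below the maximum on the part of the sphere inside
  -- the touching ball; ε fits in that gap. Outside the ball the barrier itself is smaller than at
  -- b.
  obtain ⟨ε, hε, hεD⟩ : ∃ ε > 0, ∀ a ∈ Metric.sphere b r, ‖ψ a - Y‖ ≤ ‖ψ b - Y‖ →
      1 / 2 * ‖ψ a‖ ^ 2 + ε < 1 / 2 * ‖x p‖ ^ 2 := by
    have hlt : ∀ a ∈ Metric.sphere b r, ‖ψ a - Y‖ ≤ ‖ψ b - Y‖ → ‖ψ a‖ ^ 2 < ‖x p‖ ^ 2 := by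
      intro a ha hle
      have ha' := Metric.sphere_subset_closedBall ha
      refine lt_of_le_of_ne (hball (hrρ ha')).2 fun h => ?_
      have hab := (hrball ha').1.1 h hle
      rw [hab, Metric.mem_sphere, dist_self] at ha
      exact hr.ne ha
    have hDc : IsCompact (Metric.sphere b r ∩ (fun a => ‖ψ a - Y‖) ⁻¹' Set.Iic ‖ψ b - Y‖) :=
      (isCompact_sphere b r).of_isClosed_subset
        (ContinuousOn.preimage_isClosed_of_isClosed
          (((hcontr.mono Metric.sphere_subset_closedBall).sub continuousOn_const).norm)
          Metric.isClosed_sphere isClosed_Iic) Set.inter_subset_left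
    rcases Set.eq_empty_or_nonempty
      (Metric.sphere b r ∩ (fun a => ‖ψ a - Y‖) ⁻¹' Set.Iic ‖ψ b - Y‖) with he | hne
    · refine ⟨1, one_pos, fun a ha hle => ?_⟩
      exact (Set.eq_empty_iff_forall_notMem.mp he a ⟨ha, hle⟩).elim
    · obtain ⟨a₀, ha₀, hmax₀⟩ := hDc.exists_isMaxOn hne (f := fun a => ‖ψ a‖ ^ 2)
        ((hcontr.mono (Set.inter_subset_left.trans Metric.sphere_subset_closedBall)).norm.pow 2)
      have h1 := hlt a₀ ha₀.1 ha₀.2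
      refine ⟨(‖x p‖ ^ 2 - ‖ψ a₀‖ ^ 2) / 4, by linarith, fun a ha hle => ?_⟩
      have h2 : ‖ψ a‖ ^ 2 ≤ ‖ψ a₀‖ ^ 2 := hmax₀ ⟨ha, hle⟩
      linarith
  set u : EuclideanSpace ℝ (Fin n) → ℝ := fun a =>
    1 / 2 * ‖ψ a‖ ^ 2 + ε * Real.exp (-α * ‖ψ a - Y‖ ^ 2) with hu
  have hbS' : ‖ψ b‖ ^ 2 = ‖x p‖ ^ 2 := hbS
  have hsphere : ∀ a ∈ Metric.sphere b r, u a < u b := by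
    intro a ha
    simp only [hu, hbS']
    rcases le_or_gt ‖ψ a - Y‖ ‖ψ b - Y‖ with hle | hgt
    · have h1 := hεD a ha hle
      have h2 : Real.exp (-α * ‖ψ a - Y‖ ^ 2) ≤ 1 := Real.exp_le_one_iff.mpr (by
        have : 0 ≤ α * ‖ψ a - Y‖ ^ 2 := by positivity
        linarith)
      have h3 := mul_le_mul_of_nonneg_left h2 hε.le
      have h4 : 0 < ε * Real.exp (-α * ‖ψ b - Y‖ ^ 2) := by positivity
      linarith
    · have h1 : ‖ψ a‖ ^ 2 ≤ ‖x p‖ ^ 2 := (hball (hrρ (Metric.sphere_subset_closedBall ha))).2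
      have h2 : Real.exp (-α * ‖ψ a - Y‖ ^ 2) < Real.exp (-α * ‖ψ b - Y‖ ^ 2) := by
        apply Real.exp_lt_exp.mpr
        have h3 : ‖ψ b - Y‖ ^ 2 < ‖ψ a - Y‖ ^ 2 := by gcongr
        have := mul_lt_mul_of_pos_left h3 hα0
        linarith
      have h3 := mul_lt_mul_of_pos_left h2 hε
      linarith
  have hucont : ContinuousOn u (Metric.closedBall b r) :=
    (continuousOn_const.mul (hcontr.norm.pow 2)).add (continuousOn_const.mul
      (Real.continuous_exp.comp_continuousOn
        (continuousOn_const.mul ((hcontr.sub continuousOn_const).norm.pow 2))))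
  obtain ⟨z, hz, hzmax⟩ := (isCompact_closedBall b r).exists_isMaxOn
    ⟨b, Metric.mem_closedBall_self hr.le⟩ hucont
  have hzball : z ∈ Metric.ball b r := by
    refine Metric.mem_ball.mpr (lt_of_le_of_ne (Metric.mem_closedBall.mp hz) fun h => ?_)
    exact (hsphere z h).not_ge (hzmax (Metric.mem_closedBall_self hr.le))
  have hzloc : IsLocalMax u z :=
    hzmax.isLocalMax (Filter.mem_of_superset (Metric.isOpen_ball.mem_nhds hzball)
      Metric.ball_subset_closedBall)
  have hzt := (hball (hrρ hz)).1
  set q := (extChartAt (𝓡 n) p).symm z with hq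
  have hqs : q ∈ (extChartAt (𝓡 n) p).source := (extChartAt (𝓡 n) p).map_target hzt
  have hqz : extChartAt (𝓡 n) p q = z := (extChartAt (𝓡 n) p).right_inv hzt
  have hloc : IsLocalMax (fun p' => 1 / 2 * ‖x p'‖ ^ 2 + ε * Real.exp (-α * ‖x p' - Y‖ ^ 2)) q := by
    have h1 : Filter.Tendsto (extChartAt (𝓡 n) p) (nhds q) (nhds z) := by
      have := (continuousAt_extChartAt' (I := 𝓡 n) hqs).tendsto
      rwa [hqz] at this
    filter_upwards [h1.eventually hzloc, extChartAt_source_mem_nhds' (I := 𝓡 n) hqs] with p' hp hps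
    simp only [hu, hψφ p' hps] at hp
    exact hp
  obtain ⟨-, T, hT, hineq⟩ := hx.barrier_of_isLocalMax 1 ε α Y hloc
  have hxq : x q = ψ z := rfl
  have ht := hT _ (hx.immersion.fderiv_chart_mem_tangentPlane p hzt v)
  have hΦz := (hrball hz).1.2
  have hin : ⟪x q - Y, meanCurvature n x q⟫_ℝ ≤ ‖ψ z - Y‖ * ‖ψ z‖ :=
    (real_inner_le_norm _ _).trans
      (mul_le_mul_of_nonneg_left (hx.norm_meanCurvature_le q) (norm_nonneg _))
  -- Here |H|² ≤ n enters: the first term of `hineq` is nonnegative, so the barrier term cannot be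
  -- positive. This contradicts the choice of α.
  have h1 : 4 * α ^ 2 * T - 2 * α * (n + ⟪x q - Y, meanCurvature n x q⟫_ℝ) ≤ 0 := by
    have h2 := hH q
    have h3 : 0 < ε * Real.exp (-α * ‖x q - Y‖ ^ 2) := by positivity
    by_contra! h4
    have := mul_pos h3 h4
    linarith
  have h2 : 2 * α * T ≤ n + ‖ψ z - Y‖ * ‖ψ z‖ := by
    have h3 : (2 * α) * (2 * α * T) ≤ (2 * α) * (n + ⟪x q - Y, meanCurvature n x q⟫_ℝ) := by
      linarith
    have := le_of_mul_le_mul_left h3 (by positivity)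
    linarith
  have h3 := mul_le_mul_of_nonneg_left h2 (sq_nonneg ‖fderiv ℝ ψ z v‖)
  have h4 := mul_le_mul_of_nonneg_left ht (show 0 ≤ 2 * α by positivity)
  change 0 < 2 * α * ⟪ψ z - Y, fderiv ℝ ψ z v⟫_ℝ ^ 2 -
    ‖fderiv ℝ ψ z v‖ ^ 2 * (n + ‖ψ z - Y‖ * ‖ψ z‖) at hΦz
  change 2 * α * ⟪ψ z - Y, fderiv ℝ ψ z v⟫_ℝ ^ 2 ≤ 2 * α * (‖fderiv ℝ ψ z v‖ ^ 2 * T) at h4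
  linarith

/-! ### Extrema of |x|² and rigidity -/

/-- At a local maximum of `|x|²` on a self-shrinker, `|𝐇|² ≥ n` and `x` is normal. -/
lemma IsSelfShrinker.of_isLocalMax_norm_sq [IsManifold (𝓡 n) ∞ M]
    {x : M → EuclideanSpace ℝ (Fin m)} (hx : IsSelfShrinker n x) {q : M}
    (hmax : IsLocalMax (fun p => ‖x p‖ ^ 2) q) :
    x q ∈ normalSpace n x q ∧ (n : ℝ) ≤ ‖meanCurvature n x q‖ ^ 2 := by
  have h : IsLocalMax
      (fun p => 1 / 2 * ‖x p‖ ^ 2 + 0 * Real.exp (-0 * ‖x p - 0‖ ^ 2)) q := by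
    filter_upwards [hmax] with p hp
    linarith
  obtain ⟨h1, T, -, h2⟩ := hx.barrier_of_isLocalMax 1 0 0 0 h
  refine ⟨fun t ht => ?_, by linarith⟩
  have := h1 t ht
  rw [real_inner_comm]
  linarith

/-- At a local minimum of `|x|²` on a self-shrinker, `|𝐇|² ≤ n`. -/
lemma IsSelfShrinker.of_isLocalMin_norm_sq [IsManifold (𝓡 n) ∞ M]
    {x : M → EuclideanSpace ℝ (Fin m)} (hx : IsSelfShrinker n x) {q : M}
    (hmin : IsLocalMin (fun p => ‖x p‖ ^ 2) q) :
    ‖meanCurvature n x q‖ ^ 2 ≤ (n : ℝ) := by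
  have h : IsLocalMax
      (fun p => -1 / 2 * ‖x p‖ ^ 2 + 0 * Real.exp (-0 * ‖x p - 0‖ ^ 2)) q := by
    filter_upwards [hmin] with p hp
    linarith
  -- The factor s = -1 turns the minimum into a maximum, and ε = 0 removes the barrier.
  obtain ⟨-, T, -, h2⟩ := hx.barrier_of_isLocalMax (-1) 0 0 0 h
  linarith

/-- On a compact self-shrinker with `|𝐇|² ≤ n` the function `|x|²` is locally constant. -/
lemma IsSelfShrinker.isLocallyConstant_norm_sq [IsManifold (𝓡 n) ∞ M] [CompactSpace M]
    {x : M → EuclideanSpace ℝ (Fin m)} (hx : IsSelfShrinker n x)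
    (hH : ∀ q : M, ‖meanCurvature n x q‖ ^ 2 ≤ (n : ℝ)) (q : M) :
    ∀ᶠ p in nhds q, ‖x p‖ ^ 2 = ‖x q‖ ^ 2 := by
  -- M need not be connected. Its components are open by local connectedness, so a maximum over a
  -- component is a local maximum on M.
  have : LocallyConnectedSpace M :=
    ChartedSpace.locallyConnectedSpace (EuclideanSpace ℝ (Fin n)) M
  have hcont : Continuous fun p => ‖x p‖ ^ 2 := hx.immersion.contMDiff.continuous.norm.pow 2
  have hC : connectedComponent q ∈ nhds q :=
    isOpen_connectedComponent.mem_nhds mem_connectedComponent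
  obtain ⟨p₀, hp₀, hmax⟩ := isClosed_connectedComponent.isCompact.exists_isMaxOn
    ⟨q, mem_connectedComponent⟩ hcont.continuousOn
  set A := connectedComponent q ∩ {p | ‖x p‖ ^ 2 = ‖x p₀‖ ^ 2} with hA
  have hAclopen : IsClopen A := by
    refine ⟨isClosed_connectedComponent.inter (isClosed_eq hcont continuous_const),
      isOpen_iff_mem_nhds.mpr ?_⟩
    rintro p ⟨hpC, hp⟩
    have hpn := isOpen_connectedComponent.mem_nhds hpC
    have hp' : ‖x p‖ ^ 2 = ‖x p₀‖ ^ 2 := hp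
    have hloc : IsLocalMax (fun p => ‖x p‖ ^ 2) p := by
      filter_upwards [hpn] with p' hp''
      rw [hp']
      exact hmax hp''
    filter_upwards [hpn, hx.eventually_norm_sq_eq hH hloc] with p' h1 h2
    exact ⟨h1, h2.trans hp'⟩
  have hsub : connectedComponent q ⊆ A :=
    isPreconnected_connectedComponent.subset_isClopen hAclopen ⟨p₀, hp₀, hp₀, rfl⟩
  filter_upwards [hC] with p hp
  exact (hsub hp).2.trans (hsub mem_connectedComponent).2.symm

/-- A self-shrinker with locally constant `|x|²` has `|𝐇|² = n` and is minimal in a sphere. -/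
lemma IsSelfShrinker.isMinimalInSphere [IsManifold (𝓡 n) ∞ M]
    {x : M → EuclideanSpace ℝ (Fin m)} (hx : IsSelfShrinker n x)
    (hconst : ∀ q : M, ∀ᶠ p in nhds q, ‖x p‖ ^ 2 = ‖x q‖ ^ 2) :
    (∀ q : M, ‖meanCurvature n x q‖ ^ 2 = (n : ℝ)) ∧ IsMinimalInSphere n (Real.sqrt n) x := by
  have hmax := fun q => hx.of_isLocalMax_norm_sq ((hconst q).mono fun p hp => hp.le)
  have hmin := fun q => hx.of_isLocalMin_norm_sq ((hconst q).mono fun p hp => hp.ge)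
  have hHn : ∀ q : M, ‖meanCurvature n x q‖ ^ 2 = (n : ℝ) := fun q =>
    le_antisymm (hmin q) (hmax q).2
  have hHx : ∀ q : M, meanCurvature n x q = -x q := fun q => by
    rw [hx.meanCurvature_eq, Submodule.starProjection_eq_self_iff.2 (hmax q).1]
  refine ⟨hHn, hx.immersion, fun q => ?_, fun q => ?_⟩
  · rw [mem_sphere_zero_iff_norm, ← hHn q, hHx q, norm_neg, Real.sqrt_sq (norm_nonneg _)]
  -- The sphere's normal space lies in the Euclidean one, so projecting onto it factors through the
  -- normal projection.
  · have h1 : sphereMeanCurvature n x q =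
        (sphereNormalSpace n x q).starProjection (meanCurvature n x q) := by
      simp only [sphereMeanCurvature, meanCurvature, metricTrace, map_sum, map_smul,
        sphereSecondFundamentalForm, secondFundamentalForm]
      refine Finset.sum_congr rfl fun i _ => Finset.sum_congr rfl fun j _ => ?_
      have hle : sphereNormalSpace n x q ≤ normalSpace n x q := inf_le_left
      exact congrArg _ (DFunLike.congr_fun
        (Submodule.starProjection_comp_starProjection_of_le hle) _).symm
    rw [h1, hHx q, map_neg, neg_eq_zero, Submodule.starProjection_apply_eq_zero_iff]
    intro t ht
    rw [real_inner_comm]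
    exact Submodule.mem_orthogonal_singleton_iff_inner_right.mp ht.2
end

end SelfShrinker

theorem proposition5p2 (n p : ℕ) {M : Type*} [TopologicalSpace M] [T2Space M] [CompactSpace M]
    [ChartedSpace (EuclideanSpace ℝ (Fin n)) M] [IsManifold (𝓡 n) ∞ M]
    (x : M → EuclideanSpace ℝ (Fin (n + p)))
    (hx : SelfShrinker.IsSelfShrinker n x)
    (hH : (∃ c : ℝ, ∀ q : M, ‖SelfShrinker.meanCurvature n x q‖ ^ 2 = c) ∨
      (∀ q : M, ‖SelfShrinker.meanCurvature n x q‖ ^ 2 ≤ (n : ℝ))) :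
    (∀ q : M, ‖SelfShrinker.meanCurvature n x q‖ ^ 2 = (n : ℝ)) ∧
      SelfShrinker.IsMinimalInSphere n (Real.sqrt n) x := by
  refine hx.isMinimalInSphere (hx.isLocallyConstant_norm_sq ?_)
  rcases hH with ⟨c, hc⟩ | hH
  · intro q
    -- A global minimum of |x|² bounds |H|² by n at one point, and constancy carries the bound to q.
    obtain ⟨p₀, -, hp₀⟩ := isCompact_univ.exists_isMinOn ⟨q, Set.mem_univ q⟩
      (hx.immersion.contMDiff.continuous.norm.pow 2).continuousOn
    rw [hc q, ← hc p₀]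
    exact hx.of_isLocalMin_norm_sq (hp₀.isLocalMin Filter.univ_mem)
  · exact hH
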